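/- A virtual flat biquandle is a set $X$ with two binary operations $a\ast b=S_b(a)$ and $a\circ b=T_b(a)$ such that, for all $a,b\in X$: $S_aS_b=S_bS_a$, $T_aT_b=T_bT_a$, $S_aT_b=T_bS_a$; $S_a=S_{T_b(a)}=S_{S_b(a)}$, $T_a=T_{S_b(a)}=T_{T_b(a)}$; and $T_aS_a=S_aT_a=\mathrm{id}$. An oriented flat virtual link diagram is a finite collection of oriented closed curves immersed in the plane with finitely many transverse double points, each marked as a flat or as a virtual crossing, considered up to planar isotopy. A v-arc of a diagram $L$ is a part of $L$ that runs from a virtual crossing to the next virtual crossing, passing straight through flat crossings; a component that passes through no virtual crossing is one v-arc. The fundamental virtual flat biquandle $VFB(L)$ is the virtual flat biquandle generated by the v-arcs of $L$ with two relations at each virtual crossing: turn the picture so that both strands run downwards; if the v-arc $a$ comes in from the upper left and the v-arc $b$ from the upper right, then the v-arc going out to the lower right is $a\ast b$ and the v-arc going out to the lower left is $b\circ a$. The flat Reidemeister moves (in all orientations and in both directions) are: removing the crossing, flat or virtual, of a monogon face; removing the two crossings of a bigon face, both flat or both virtual; and moving the three strands at a triangular face with three distinct crossings across each other, where the three crossings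 are all flat, or all virtual, or one flat and two virtual. **Theorem 4.3.** (i) Every virtual flat biquandle satisfies the axioms of a flat biquandle, that is, for all $a,b,c$: 1. there are unique $x,y$ with $a\circ x=x$, $x\ast a=a$, $y\circ a=a$, $a\ast y=y$; 2. there are unique $x,y$ with $x=b\circ y$, $y=a\circ x$, $b=x\ast a$, $a=y\ast b$; moreover $(a\circ b)\ast(b\ast a)=a$ and $(b\ast a)\circ(a\circ b)=b$; 3. $(a\circ b)\circ c=(a\circ(c\ast b))\circ(b\circ c)$, $(c\ast b)\ast a=(c\ast(a\circ b))\ast(b\ast a)$ and $(b\circ c)\ast(a\circ(c\ast b))=(b\ast a)\circ(c\ast(a\circ b))$. (ii) If $L$ and $L'$ are oriented flat virtual link diagrams and $L$ can be transformed into $L'$ by one flat Reidemeister move, then the virtual flat biquandles $VFB(L)$ and $VFB(L')$ are isomorphic. -/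

import Mathlib

/-- A virtual flat biquandle: with `S_b a = star a b` (written `a ∗ b`) and
`T_b a = circ a b` (written `a ∘ b`), all the maps `S_a`, `T_b` commute with one another,
`S_a` and `T_a` do not change when `a` is replaced by `T_b a` or `S_b a`, and
`S_a`, `T_a` are inverse to each other. -/
class VirtualFlatBiquandle (X : Type*) where
  star : X → X → X
  circ : X → X → X
  star_star_comm : ∀ x a b, star (star x b) a = star (star x a) b
  circ_circ_comm : ∀ x a b, circ (circ x b) a = circ (circ x a) b
  star_circ_comm : ∀ x a b, star (circ x b) a = circ (star x a) b
  star_of_circ : ∀ x a b, star x (circ a b) = star x a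
  star_of_star : ∀ x a b, star x (star a b) = star x a
  circ_of_star : ∀ x a b, circ x (star a b) = circ x a
  circ_of_circ : ∀ x a b, circ x (circ a b) = circ x a
  circ_star_self : ∀ x a, circ (star x a) a = x
  star_circ_self : ∀ x a, star (circ x a) a = x

/-- The axioms of a flat biquandle (semiquandle) for two binary operations. -/
structure IsFlatBiquandle {X : Type*} (star circ : X → X → X) : Prop where
  axiom1 : ∀ a, ∃! p : X × X,
    circ a p.1 = p.1 ∧ star p.1 a = a ∧ circ p.2 a = a ∧ star a p.2 = p.2
  axiom2 : ∀ a b,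
    (∃! p : X × X,
      p.1 = circ b p.2 ∧ p.2 = circ a p.1 ∧ b = star p.1 a ∧ a = star p.2 b) ∧
    star (circ a b) (star b a) = a ∧ circ (star b a) (circ a b) = b
  axiom3 : ∀ a b c,
    circ (circ a b) c = circ (circ a (star c b)) (circ b c) ∧
    star (star c b) a = star (star c (circ a b)) (star b a) ∧
    star (circ b c) (circ a (star c b)) = circ (star b a) (star c (circ a b))

/-- Isomorphisms of virtual flat biquandles: bijections preserving both operations. -/
structure VFBIso (X Y : Type*) [VirtualFlatBiquandle X] [VirtualFlatBiquandle Y]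
    extends X ≃ Y where
  map_star : ∀ a b, toFun (VirtualFlatBiquandle.star a b) =
    VirtualFlatBiquandle.star (toFun a) (toFun b)
  map_circ : ∀ a b, toFun (VirtualFlatBiquandle.circ a b) =
    VirtualFlatBiquandle.circ (toFun a) (toFun b)

/-! ### Virtual flat biquandles given by generators and relations -/

/-- Formal words in two binary operations on a set `G` of generators. -/
inductive VFBWord (G : Type*) where
  | gen : G → VFBWord G
  | star : VFBWord G → VFBWord G → VFBWord G
  | circ : VFBWord G → VFBWord G → VFBWord G

/-- The smallest congruence on words that contains the relations `R` and all instances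
of the virtual flat biquandle axioms. -/
inductive VFBCongr {G : Type*} (R : VFBWord G → VFBWord G → Prop) :
    VFBWord G → VFBWord G → Prop where
  | of : ∀ {v w}, R v w → VFBCongr R v w
  | refl : ∀ w, VFBCongr R w w
  | symm : ∀ {v w}, VFBCongr R v w → VFBCongr R w v
  | trans : ∀ {u v w}, VFBCongr R u v → VFBCongr R v w → VFBCongr R u w
  | star_congr : ∀ {v v' w w'}, VFBCongr R v v' → VFBCongr R w w' →
      VFBCongr R (.star v w) (.star v' w')
  | circ_congr : ∀ {v v' w w'}, VFBCongr R v v' → VFBCongr R w w' →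
      VFBCongr R (.circ v w) (.circ v' w')
  | star_star_comm : ∀ x a b, VFBCongr R (.star (.star x b) a) (.star (.star x a) b)
  | circ_circ_comm : ∀ x a b, VFBCongr R (.circ (.circ x b) a) (.circ (.circ x a) b)
  | star_circ_comm : ∀ x a b, VFBCongr R (.star (.circ x b) a) (.circ (.star x a) b)
  | star_of_circ : ∀ x a b, VFBCongr R (.star x (.circ a b)) (.star x a)
  | star_of_star : ∀ x a b, VFBCongr R (.star x (.star a b)) (.star x a)
  | circ_of_star : ∀ x a b, VFBCongr R (.circ x (.star a b)) (.circ x a)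
  | circ_of_circ : ∀ x a b, VFBCongr R (.circ x (.circ a b)) (.circ x a)
  | circ_star_self : ∀ x a, VFBCongr R (.circ (.star x a) a) x
  | star_circ_self : ∀ x a, VFBCongr R (.star (.circ x a) a) x

/-- `VFBCongr R` as a setoid. -/
def vfbSetoid {G : Type*} (R : VFBWord G → VFBWord G → Prop) : Setoid (VFBWord G) where
  r := VFBCongr R
  iseqv := ⟨VFBCongr.refl, VFBCongr.symm, VFBCongr.trans⟩

/-- The virtual flat biquandle with generators `G` and relations `R`. -/
def PresentedVFB {G : Type*} (R : VFBWord G → VFBWord G → Prop) : Type _ :=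
  Quotient (vfbSetoid R)

instance {G : Type*} (R : VFBWord G → VFBWord G → Prop) :
    VirtualFlatBiquandle (PresentedVFB R) where
  star := Quotient.map₂ VFBWord.star (fun _ _ h _ _ k => VFBCongr.star_congr h k)
  circ := Quotient.map₂ VFBWord.circ (fun _ _ h _ _ k => VFBCongr.circ_congr h k)
  star_star_comm := by
    rintro ⟨x⟩ ⟨a⟩ ⟨b⟩; exact Quotient.sound (VFBCongr.star_star_comm x a b)
  circ_circ_comm := by
    rintro ⟨x⟩ ⟨a⟩ ⟨b⟩; exact Quotient.sound (VFBCongr.circ_circ_comm x a b)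
  star_circ_comm := by
    rintro ⟨x⟩ ⟨a⟩ ⟨b⟩; exact Quotient.sound (VFBCongr.star_circ_comm x a b)
  star_of_circ := by
    rintro ⟨x⟩ ⟨a⟩ ⟨b⟩; exact Quotient.sound (VFBCongr.star_of_circ x a b)
  star_of_star := by
    rintro ⟨x⟩ ⟨a⟩ ⟨b⟩; exact Quotient.sound (VFBCongr.star_of_star x a b)
  circ_of_star := by
    rintro ⟨x⟩ ⟨a⟩ ⟨b⟩; exact Quotient.sound (VFBCongr.circ_of_star x a b)
  circ_of_circ := by
    rintro ⟨x⟩ ⟨a⟩ ⟨b⟩; exact Quotient.sound (VFBCongr.circ_of_circ x a b)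
  circ_star_self := by
    rintro ⟨x⟩ ⟨a⟩; exact Quotient.sound (VFBCongr.circ_star_self x a)
  star_circ_self := by
    rintro ⟨x⟩ ⟨a⟩; exact Quotient.sound (VFBCongr.star_circ_self x a)

/-! ### Flat virtual link diagrams -/

/-- An oriented flat virtual link diagram on a closed oriented surface, as a combinatorial map.

Turn the picture at a crossing so that both strands run downwards. Then the crossing is run
through once by the strand that comes in from the upper left (and leaves to the lower right)
and once by the strand that comes in from the upper right (and leaves to the lower left).
These two *passes* of a crossing `x` are `(x, true)` (from the left) and `(x, false)` (from
the right). A diagram is a finite set of crossings, each virtual or flat, the permutation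
`next` that sends a pass to the pass that follows it along the orientation, and a number of
components that have no crossing at all. The edge of the diagram that leaves a pass `p` runs to
`next p`, so edges are indexed by passes. -/
structure SurfaceDiagram where
  Crossing : Type
  finite : Finite Crossing
  /-- the crossings for which this fails are the flat ones -/
  IsVirtual : Crossing → Prop
  next : Equiv.Perm (Crossing × Bool)
  circles : ℕ

namespace SurfaceDiagram

/-- The edge ends at the crossings: `(p, false)` is the end at which pass `p` arrives at its
crossing, `(p, true)` the one along which it leaves. -/
abbrev Dart (L : SurfaceDiagram) : Type := (L.Crossing × Bool) × Bool

/-- The two ends of an edge are interchanged. -/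
def opposite (L : SurfaceDiagram) : L.Dart → L.Dart
  | (p, true) => (L.next p, false)
  | (p, false) => (L.next.symm p, true)

/-- The next edge end at the same crossing in clockwise order. With both strands running
downwards, the clockwise order is: upper left, upper right, lower right, lower left. -/
def clockwise (L : SurfaceDiagram) : L.Dart → L.Dart
  | ((x, true), false) => ((x, false), false)
  | ((x, false), false) => ((x, true), true)
  | ((x, true), true) => ((x, false), true)
  | ((x, false), true) => ((x, true), false)

/-- The inverse of `clockwise`. -/
def counterclockwise (L : SurfaceDiagram) : L.Dart → L.Dart
  | ((x, false), false) => ((x, true), false)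
  | ((x, true), true) => ((x, false), false)
  | ((x, false), true) => ((x, true), true)
  | ((x, true), false) => ((x, false), true)

theorem opposite_opposite (L : SurfaceDiagram) (d : L.Dart) :
    L.opposite (L.opposite d) = d := by
  obtain ⟨p, _ | _⟩ := d <;> simp [opposite]

/-- The walk around the faces: from a crossing along an edge to its other end, and there
turn left. Its cycles are the boundaries of the faces, each face lying to the left. -/
def face (L : SurfaceDiagram) : Equiv.Perm L.Dart where
  toFun d := L.clockwise (L.opposite d)
  invFun d := L.opposite (L.counterclockwise d)
  left_inv d := by
    have h : ∀ c, L.counterclockwise (L.clockwise c) = c := by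
      rintro ⟨⟨x, _ | _⟩, _ | _⟩ <;> rfl
    simp only [h, L.opposite_opposite]
  right_inv d := by
    simp only [L.opposite_opposite]
    obtain ⟨⟨x, _ | _⟩, _ | _⟩ := d <;> rfl

/-- The crossing at which a dart sits. -/
def crossingOf (L : SurfaceDiagram) (d : L.Dart) : L.Crossing := d.1.1

/-- The edge to which a dart belongs, named by the pass that it leaves. -/
def edgeOf (L : SurfaceDiagram) : L.Dart → L.Crossing × Bool
  | (p, true) => p
  | (p, false) => L.next.symm p

/-- The number of faces of the diagram. -/
noncomputable def numFaces (L : SurfaceDiagram) : ℕ :=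
  Nat.card (Quotient (Equiv.Perm.SameCycle.setoid L.face))

/-- The number of connected components of the four-valent graph formed by the crossings and
the edges between them (components without crossings are not counted). -/
noncomputable def numParts (L : SurfaceDiagram) : ℕ :=
  Nat.card (Quot fun x y : L.Crossing => ∃ s : Bool, (L.next (x, s)).1 = y)

/-- Every connected part of the diagram has genus zero. There are `V` crossings and `2 V`
edges, so Euler's formula `V - 2 V + F = 2 C` reads `F = V + 2 C`. -/
def IsPlanar (L : SurfaceDiagram) : Prop :=
  L.numFaces = Nat.card L.Crossing + 2 * L.numParts

/-! ### The fundamental virtual flat biquandle -/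

/-- One edge is followed by another one at a flat crossing. -/
def FlatStep (L : SurfaceDiagram) (p q : L.Crossing × Bool) : Prop :=
  q = L.next p ∧ ¬ L.IsVirtual q.1

/-- The v-arcs: maximal parts of the diagram without virtual crossing in their interior. Two
edges lie on the same v-arc when they are joined by steps through flat crossings; a component
without crossings is a v-arc by itself. -/
def VArc (L : SurfaceDiagram) : Type := Quot L.FlatStep ⊕ Fin L.circles

/-- The v-arc along which the pass `p` leaves its crossing. -/
def outArc (L : SurfaceDiagram) (p : L.Crossing × Bool) : L.VArc := Sum.inl (Quot.mk _ p)

/-- The v-arc along which the pass `p` arrives at its crossing. -/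
def inArc (L : SurfaceDiagram) (p : L.Crossing × Bool) : L.VArc := L.outArc (L.next.symm p)

/-- At a virtual crossing, where `a` comes in from the left and `b` from the right, the strand
of `a` goes on as `a ∗ b` and the strand of `b` goes on as `b ∘ a`. -/
inductive VirtualRel (L : SurfaceDiagram) : VFBWord L.VArc → VFBWord L.VArc → Prop where
  | left : ∀ x, L.IsVirtual x → VirtualRel L (.gen (L.outArc (x, true)))
      (.star (.gen (L.inArc (x, true))) (.gen (L.inArc (x, false))))
  | right : ∀ x, L.IsVirtual x → VirtualRel L (.gen (L.outArc (x, false)))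
      (.circ (.gen (L.inArc (x, false))) (.gen (L.inArc (x, true))))

/-- The virtual flat biquandle generated by the v-arcs with the relations at the virtual
crossings. -/
abbrev VFB (L : SurfaceDiagram) : Type := PresentedVFB L.VirtualRel

/-! ### Flat Reidemeister moves -/

/-- `K` is, up to renaming of crossings, the diagram that is left of `L` when the strands of `L`
are pulled apart at the crossings in `R`: along each component of `L` the passes of these
crossings are skipped, and a component all of whose crossings are in `R` becomes a component
without crossings. -/
def IsResultOfRemoving (K L : SurfaceDiagram) (R : L.Crossing → Prop) : Prop :=
  ∃ e : K.Crossing ≃ {x : L.Crossing // ¬ R x},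
    (∀ x, K.IsVirtual x ↔ L.IsVirtual (e x)) ∧
    (∀ x s, ∃ k : ℕ,
      (L.next ^ (k + 1)) (↑(e x), s) = (↑(e (K.next (x, s)).1), (K.next (x, s)).2) ∧
      ∀ j < k, R ((L.next ^ (j + 1)) (↑(e x), s)).1) ∧
    K.circles = L.circles + Nat.card
      {c : Quotient (Equiv.Perm.SameCycle.setoid L.next) //
        ∀ p, Quotient.mk _ p = c → R p.1}

/-- First flat Reidemeister move, for a flat or a virtual crossing: a crossing at a corner of a
face with one edge is removed. -/
def MoveOne (L K : SurfaceDiagram) : Prop :=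
  ∃ d : L.Dart, L.face d = d ∧ K.IsResultOfRemoving L (fun x => x = L.crossingOf d)

/-- Second flat Reidemeister move: the two distinct crossings of a face with two edges, both
flat or both virtual, are removed. -/
def MoveTwo (L K : SurfaceDiagram) : Prop :=
  ∃ d : L.Dart, L.face (L.face d) = d ∧
    L.crossingOf d ≠ L.crossingOf (L.face d) ∧
    (L.IsVirtual (L.crossingOf d) ↔ L.IsVirtual (L.crossingOf (L.face d))) ∧
    K.IsResultOfRemoving L (fun x => x = L.crossingOf d ∨ x = L.crossingOf (L.face d))

open Classical in
/-- Interchange of the passes at the two ends of the edge of `d`. -/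
noncomputable def swapEnds (L : SurfaceDiagram) (d : L.Dart) :
    Equiv.Perm (L.Crossing × Bool) :=
  Equiv.swap (L.edgeOf d) (L.next (L.edgeOf d))

/-- Third flat Reidemeister move: each strand is moved over the crossing of the two other ones at
a triangular face with three distinct crossings, so that along each of the three strands the
order of its two crossings is reversed. Either all three crossings are flat, or all are
virtual, or exactly two are virtual; two flat crossings and a virtual one are not allowed. -/
def MoveThree (L K : SurfaceDiagram) : Prop :=
  ∃ d₁ d₂ d₃ : L.Dart, L.face d₁ = d₂ ∧ L.face d₂ = d₃ ∧ L.face d₃ = d₁ ∧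
    L.crossingOf d₁ ≠ L.crossingOf d₂ ∧ L.crossingOf d₂ ≠ L.crossingOf d₃ ∧
    L.crossingOf d₃ ≠ L.crossingOf d₁ ∧
    ({d | (d = d₁ ∨ d = d₂ ∨ d = d₃) ∧ L.IsVirtual (L.crossingOf d)} : Set L.Dart).ncard ≠ 1 ∧
    ∃ e : L.Crossing ≃ K.Crossing,
      (∀ x, L.IsVirtual x ↔ K.IsVirtual (e x)) ∧
      (∀ p : L.Crossing × Bool,
        K.next (Prod.map e id
          ((L.swapEnds d₁ * L.swapEnds d₂ * L.swapEnds d₃) p)) =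
        Prod.map e id ((L.swapEnds d₁ * L.swapEnds d₂ * L.swapEnds d₃) (L.next p))) ∧
      K.circles = L.circles

/-- `K` and `L` differ by one flat Reidemeister move, performed in either direction. -/
def FlatReidemeister (L K : SurfaceDiagram) : Prop :=
  MoveOne L K ∨ MoveOne K L ∨ MoveTwo L K ∨ MoveTwo K L ∨ MoveThree L K ∨ MoveThree K L

end SurfaceDiagram

/-- An oriented flat virtual link diagram (in the plane), up to planar isotopy. -/
structure FlatVirtualLinkDiagram extends SurfaceDiagram where
  planar : toSurfaceDiagram.IsPlanar

/-!
In a virtual flat biquandle all the operators `S_a` and `T_a = S_a⁻¹` commute, and `S_{b ∗ a}` and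
`S_{b ∘ a}` both equal `S_b`. The flat biquandle axioms are direct consequences.

For the invariance, a colouring of a diagram `L` in `X` gives each edge an element of `X`, subject
to the relations at the crossings. The fundamental virtual flat biquandle represents the functor
of colourings, so it suffices to find natural bijections between colourings
(`nonempty_iso_of_natural`). When a strand passes a virtual crossing, its colour is acted upon by
`S_b` or `T_b`, depending on its side, with `b` the colour of the other strand. Since
`S_{b ∗ a} = S_{b ∘ a} = S_b`, all colours of one component of `L` act in the same way
(`IsColoring.parallel_of_sameCycle`). So the effect of a pass depends only on the side and on the
component that is met, and effects of different passes commute.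

* At a monogon or a bigon each strand goes through two consecutive passes from opposite sides,
  which meet the same component. Their effects cancel, so the crossings may be made flat
  (`Cancels.nonempty_iso_flatten`), and flat crossings may be removed at will
  (`IsResultOfRemoving.nonempty_iso_of_flat`).
* The triangle move interchanges two consecutive passes on each of three strands. Such an
  interchange only changes the colour between the two passes (`nonempty_iso_interchange`).
-/

/-! ### Operators of virtual flat biquandles -/

namespace VirtualFlatBiquandle

variable {X : Type*} [VirtualFlatBiquandle X]

/-- The operator `S_b` (for `s = true`) or `T_b = S_b⁻¹` (for `s = false`) applied to `x`. The
sign `s` is the side from which a strand of colour `x` meets a strand of colour `b`. -/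
def act (s : Bool) (b x : X) : X :=
  match s with
  | true => star x b
  | false => circ x b

theorem act_act_left (s s' : Bool) (c b x : X) : act s (act s' c b) x = act s b x := by
  cases s <;> cases s' <;>
    simp [act, star_of_circ, star_of_star, circ_of_star, circ_of_circ]

theorem act_comm (s s' : Bool) (a b x : X) :
    act s a (act s' b x) = act s' b (act s a x) := by
  cases s <;> cases s'
  · exact circ_circ_comm x a b
  · exact (star_circ_comm x b a).symm
  · exact star_circ_comm x a b
  · exact star_star_comm x a b

theorem act_not_act (s : Bool) (a x : X) : act (!s) a (act s a x) = x := by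
  cases s
  · exact star_circ_self x a
  · exact circ_star_self x a

/-- Two elements are parallel when they act on `X` by the same operators. -/
def Parallel (a b : X) : Prop := ∀ s x, act s a x = act s b x

theorem Parallel.refl (a : X) : Parallel a a := fun _ _ => rfl

theorem Parallel.symm {a b : X} (h : Parallel a b) : Parallel b a := fun s x => (h s x).symm

theorem Parallel.trans {a b c : X} (h : Parallel a b) (k : Parallel b c) : Parallel a c :=
  fun s x => (h s x).trans (k s x)

theorem isFlatBiquandle : IsFlatBiquandle (star : X → X → X) circ where
  axiom1 a := by
    refine ⟨(circ a a, star a a), ?_, ?_⟩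
    · simp [circ_of_circ, star_of_star, star_circ_self, circ_star_self]
    · rintro ⟨x, y⟩ ⟨-, h2, h3, -⟩
      have hx := circ_star_self x a
      have hy := star_circ_self y a
      simp only at h2 h3
      rw [h2] at hx
      rw [h3] at hy
      rw [hx, hy]
  axiom2 a b := by
    refine ⟨⟨(circ b a, circ a b), ?_, ?_⟩, ?_, ?_⟩
    · simp [circ_of_circ, star_circ_self]
    · rintro ⟨x, y⟩ ⟨-, -, h3, h4⟩
      have hx := circ_star_self x a
      have hy := circ_star_self y b
      simp only at h3 h4
      rw [← h3] at hx
      rw [← h4] at hy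
      rw [hx, hy]
    · simp [star_of_star, star_circ_self]
    · simp [circ_of_circ, circ_star_self]
  axiom3 a b c := by
    refine ⟨?_, ?_, ?_⟩
    · rw [circ_of_circ, circ_of_star, circ_circ_comm]
    · rw [star_of_star, star_of_circ, star_star_comm]
    · rw [star_of_circ, circ_of_star, star_circ_comm]

end VirtualFlatBiquandle

/-! ### Homomorphisms and presentations -/

open VirtualFlatBiquandle in
/-- Homomorphisms of virtual flat biquandles. -/
structure VFBHom (X Y : Type*) [VirtualFlatBiquandle X] [VirtualFlatBiquandle Y] where
  toFun : X → Y
  map_star : ∀ a b, toFun (star a b) = star (toFun a) (toFun b)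
  map_circ : ∀ a b, toFun (circ a b) = circ (toFun a) (toFun b)

theorem VFBHom.map_act {X Y : Type*} [VirtualFlatBiquandle X] [VirtualFlatBiquandle Y]
    (f : VFBHom X Y) (s : Bool) (b x : X) :
    f.toFun (VirtualFlatBiquandle.act s b x) =
      VirtualFlatBiquandle.act s (f.toFun b) (f.toFun x) := by
  cases s
  · exact f.map_circ x b
  · exact f.map_star x b

namespace VFBIso

variable {X Y Z : Type*} [VirtualFlatBiquandle X] [VirtualFlatBiquandle Y]
  [VirtualFlatBiquandle Z]

def symm (f : VFBIso X Y) : VFBIso Y X where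
  toEquiv := f.toEquiv.symm
  map_star a b := f.toEquiv.injective (by
    have h := f.map_star (f.toEquiv.symm a) (f.toEquiv.symm b)
    simpa using h.symm)
  map_circ a b := f.toEquiv.injective (by
    have h := f.map_circ (f.toEquiv.symm a) (f.toEquiv.symm b)
    simpa using h.symm)

def trans (f : VFBIso X Y) (g : VFBIso Y Z) : VFBIso X Z where
  toEquiv := f.toEquiv.trans g.toEquiv
  map_star a b := (congrArg g.toFun (f.map_star a b)).trans (g.map_star _ _)
  map_circ a b := (congrArg g.toFun (f.map_circ a b)).trans (g.map_circ _ _)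

end VFBIso

namespace PresentedVFB

open VirtualFlatBiquandle

variable {G : Type*} {R : VFBWord G → VFBWord G → Prop} {X : Type*} [VirtualFlatBiquandle X]

/-- The value of a word when the generators have the values `v`. -/
def eval (v : G → X) : VFBWord G → X
  | .gen g => v g
  | .star a b => star (eval v a) (eval v b)
  | .circ a b => circ (eval v a) (eval v b)

theorem eval_eq_of_congr (v : G → X) (hv : ∀ a b, R a b → eval v a = eval v b)
    {a b : VFBWord G} (h : VFBCongr R a b) : eval v a = eval v b := by
  induction h with
  | of h => exact hv _ _ h
  | refl => rfl
  | symm _ ih => exact ih.symm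
  | trans _ _ ih₁ ih₂ => exact ih₁.trans ih₂
  | star_congr _ _ ih₁ ih₂ => simp only [eval, ih₁, ih₂]
  | circ_congr _ _ ih₁ ih₂ => simp only [eval, ih₁, ih₂]
  | star_star_comm => exact star_star_comm _ _ _
  | circ_circ_comm => exact circ_circ_comm _ _ _
  | star_circ_comm => exact star_circ_comm _ _ _
  | star_of_circ => exact star_of_circ _ _ _
  | star_of_star => exact star_of_star _ _ _
  | circ_of_star => exact circ_of_star _ _ _
  | circ_of_circ => exact circ_of_circ _ _ _
  | circ_star_self => exact circ_star_self _ _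
  | star_circ_self => exact star_circ_self _ _

/-- The class of a generator. -/
def of (R : VFBWord G → VFBWord G → Prop) (g : G) : PresentedVFB R :=
  Quotient.mk (vfbSetoid R) (.gen g)

/-- The homomorphism given by values of the generators that satisfy the relations. -/
def lift (v : G → X) (hv : ∀ a b, R a b → eval v a = eval v b) :
    VFBHom (PresentedVFB R) X where
  toFun := Quotient.lift (eval v) fun _ _ h => eval_eq_of_congr v hv h
  map_star := by rintro ⟨a⟩ ⟨b⟩; rfl
  map_circ := by rintro ⟨a⟩ ⟨b⟩; rfl

theorem hom_ext (f g : VFBHom (PresentedVFB R) X)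
    (h : ∀ x, f.toFun (of R x) = g.toFun (of R x)) (a : PresentedVFB R) :
    f.toFun a = g.toFun a := by
  obtain ⟨w⟩ := a
  change f.toFun (Quotient.mk (vfbSetoid R) w) = g.toFun (Quotient.mk (vfbSetoid R) w)
  induction w with
  | gen x => exact h x
  | star v w ihv ihw =>
    have hf := f.map_star (Quotient.mk (vfbSetoid R) v) (Quotient.mk (vfbSetoid R) w)
    have hg := g.map_star (Quotient.mk (vfbSetoid R) v) (Quotient.mk (vfbSetoid R) w)
    rw [ihv, ihw] at hf
    exact hf.trans hg.symm
  | circ v w ihv ihw =>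
    have hf := f.map_circ (Quotient.mk (vfbSetoid R) v) (Quotient.mk (vfbSetoid R) w)
    have hg := g.map_circ (Quotient.mk (vfbSetoid R) v) (Quotient.mk (vfbSetoid R) w)
    rw [ihv, ihw] at hf
    exact hf.trans hg.symm

end PresentedVFB

namespace SurfaceDiagram

open VirtualFlatBiquandle

/-! ### Colourings -/

section IsColoring

variable {C : Type*} {X Y : Type*} [VirtualFlatBiquandle X] [VirtualFlatBiquandle Y]

/-- The other pass of the same crossing. -/
def partner (p : C × Bool) : C × Bool := (p.1, !p.2)

open Classical in
/-- What happens to a strand of colour `x` at the pass `p`, when the strand that it meets has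
colour `b`: it is acted upon at a crossing in `V` (the virtual ones) and stays the same at a flat
crossing. -/
noncomputable def pass (V : C → Prop) (p : C × Bool) (b x : X) : X :=
  if V p.1 then act p.2 b x else x

variable {V : C → Prop} {n : Equiv.Perm (C × Bool)} {c : C × Bool → X}

theorem pass_of_flat {p : C × Bool} (h : ¬ V p.1) (b x : X) : pass V p b x = x := if_neg h

theorem pass_parallel (p : C × Bool) (b x : X) : Parallel (pass V p b x) x := by
  intro s y
  unfold pass
  split_ifs
  · exact act_act_left _ _ _ _ _
  · rfl

theorem pass_congr (p : C × Bool) {b b' : X} (h : Parallel b b') (x : X) :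
    pass V p b x = pass V p b' x := by
  unfold pass
  split_ifs
  · exact h _ _
  · rfl

theorem pass_comm (p q : C × Bool) (a b x : X) :
    pass V p a (pass V q b x) = pass V q b (pass V p a x) := by
  unfold pass
  split_ifs
  · exact act_comm _ _ _ _ _
  all_goals rfl

/-- Two passes from opposite sides through strands that act in the same way cancel. -/
theorem pass_pass_cancel {p q : C × Bool} (hv : V p.1 ↔ V q.1)
    (hs : q.2 = !p.2) {a b : X} (h : Parallel a b) (x : X) :
    pass V q b (pass V p a x) = x := by
  unfold pass
  by_cases hp : V p.1
  · rw [if_pos hp, if_pos (hv.1 hp), hs, h, act_not_act]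
  · rw [if_neg hp, if_neg fun k => hp (hv.2 k)]

theorem map_pass (f : VFBHom X Y) (p : C × Bool) (b x : X) :
    f.toFun (pass V p b x) = pass V p (f.toFun b) (f.toFun x) := by
  unfold pass
  split_ifs
  · exact f.map_act _ _ _
  · rfl

/-- The colours `c` of the edges, each named by the pass that it leaves, satisfy the relations at
the crossings: each strand is acted upon by the colour with which the other strand leaves. As both
colours of that strand act in the same way, its incoming colour could be used just as well. -/
def IsColoring (V : C → Prop) (n : Equiv.Perm (C × Bool)) (c : C × Bool → X) : Prop :=
  ∀ p, c p = pass V p (c (partner p)) (c (n.symm p))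

theorem IsColoring.next (h : IsColoring V n c) (p : C × Bool) :
    c (n p) = pass V (n p) (c (partner (n p))) (c p) := by
  have k := h (n p)
  rwa [Equiv.symm_apply_apply] at k

theorem IsColoring.parallel_prev (h : IsColoring V n c) (p : C × Bool) :
    Parallel (c p) (c (n.symm p)) := by
  rw [h p]
  exact pass_parallel _ _ _

/-- All colours of a component of the diagram act in the same way. -/
theorem IsColoring.parallel_of_sameCycle [Finite C] (h : IsColoring V n c) {p q : C × Bool}
    (hpq : n.SameCycle p q) : Parallel (c p) (c q) := by
  obtain ⟨k, rfl⟩ := hpq.exists_nat_pow_eq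
  clear hpq
  induction k with
  | zero => exact Parallel.refl _
  | succ k ih =>
    have hk := h.parallel_prev ((n ^ (k + 1)) p)
    rw [pow_succ', Equiv.Perm.mul_apply, Equiv.symm_apply_apply] at hk
    rw [pow_succ', Equiv.Perm.mul_apply]
    exact ih.trans hk.symm

end IsColoring

/-- A colouring of the edges of `L`, each named by the pass that it leaves, and of its components
without crossings by elements of `X`. -/
@[ext]
structure Coloring (L : SurfaceDiagram) (X : Type*) [VirtualFlatBiquandle X] where
  color : L.Crossing × Bool → X
  circleColor : Fin L.circles → X
  isColoring : IsColoring L.IsVirtual L.next color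

namespace Coloring

variable {L : SurfaceDiagram} {X Y : Type*} [VirtualFlatBiquandle X] [VirtualFlatBiquandle Y]

/-- The image of a colouring under a homomorphism. -/
def map (f : VFBHom X Y) (c : L.Coloring X) : L.Coloring Y where
  color p := f.toFun (c.color p)
  circleColor i := f.toFun (c.circleColor i)
  isColoring p := by rw [← map_pass, ← c.isColoring p]

/-- The values of a colouring on the v-arcs. -/
def arcColor (c : L.Coloring X) : L.VArc → X :=
  Sum.elim (Quot.lift c.color (by
    rintro p q ⟨rfl, h⟩
    rw [c.isColoring.next, pass_of_flat h])) c.circleColor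

/-- The homomorphism from the fundamental virtual flat biquandle given by a colouring. -/
def lift (c : L.Coloring X) : VFBHom L.VFB X :=
  PresentedVFB.lift c.arcColor (by
    have key : ∀ x s, L.IsVirtual x → c.color (x, s) =
        act s (c.color (L.next.symm (x, !s))) (c.color (L.next.symm (x, s))) := by
      intro x s hx
      rw [c.isColoring]
      exact (if_pos hx).trans (c.isColoring.parallel_prev (x, !s) _ _)
    rintro _ _ (⟨x, hx⟩ | ⟨x, hx⟩)
    · exact key x true hx
    · exact key x false hx)

variable (L) in
/-- The colouring of the edges by the v-arcs to which they belong. -/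
def universal : L.Coloring L.VFB where
  color p := PresentedVFB.of L.VirtualRel (L.outArc p)
  circleColor i := PresentedVFB.of L.VirtualRel (Sum.inr i)
  isColoring := by
    -- The presentation has the incoming colours; they are replaced by the outgoing ones.
    have key : ∀ x s, L.IsVirtual x → PresentedVFB.of L.VirtualRel (L.outArc (x, s)) =
        act s (PresentedVFB.of L.VirtualRel (L.inArc (x, !s)))
          (PresentedVFB.of L.VirtualRel (L.inArc (x, s))) := by
      rintro x (_ | _) hx
      · exact Quotient.sound (VFBCongr.of (VirtualRel.right x hx))
      · exact Quotient.sound (VFBCongr.of (VirtualRel.left x hx))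
    rintro ⟨x, s⟩
    unfold pass
    split_ifs with hx
    · refine (key x s hx).trans ?_
      change _ = act s (PresentedVFB.of L.VirtualRel (L.outArc (x, !s)))
        (PresentedVFB.of L.VirtualRel (L.inArc (x, s)))
      rw [key x (!s) hx, act_act_left]
    · refine congrArg (fun a => PresentedVFB.of L.VirtualRel (Sum.inl a)) (Quot.sound ?_).symm
      exact ⟨(L.next.apply_symm_apply _).symm, hx⟩

theorem map_lift_universal (c : L.Coloring X) : (universal L).map c.lift = c := rfl

theorem hom_ext {f g : VFBHom L.VFB X} (h : (universal L).map f = (universal L).map g)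
    (a : L.VFB) : f.toFun a = g.toFun a := by
  refine PresentedVFB.hom_ext f g ?_ a
  rintro (a | i)
  · obtain ⟨p, rfl⟩ := Quot.exists_rep a
    exact congrFun (congrArg Coloring.color h) p
  · exact congrFun (congrArg Coloring.circleColor h) i

end Coloring

/-- The fundamental virtual flat biquandle represents the functor of colourings, so a natural
bijection between the colourings of two diagrams gives an isomorphism. -/
theorem nonempty_iso_of_natural {L K : SurfaceDiagram}
    (Φ : ∀ (X : Type) [VirtualFlatBiquandle X], L.Coloring X → K.Coloring X)
    (hΦ : ∀ (X : Type) [VirtualFlatBiquandle X], Function.Bijective (Φ X))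
    (nat : ∀ (X Y : Type) [VirtualFlatBiquandle X] [VirtualFlatBiquandle Y]
      (f : VFBHom X Y) (c : L.Coloring X), Φ Y (c.map f) = (Φ X c).map f) :
    Nonempty (VFBIso L.VFB K.VFB) := by
  obtain ⟨c, hc⟩ := (hΦ K.VFB).2 (Coloring.universal K)
  let f : VFBHom L.VFB K.VFB := c.lift
  let g : VFBHom K.VFB L.VFB := (Φ L.VFB (Coloring.universal L)).lift
  have hf : (Coloring.universal L).map f = c := Coloring.map_lift_universal _
  have hg : (Coloring.universal K).map g = Φ L.VFB (Coloring.universal L) :=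
    Coloring.map_lift_universal _
  have hgf : c.map g = Coloring.universal L := by
    apply (hΦ L.VFB).1
    rw [nat, hc, hg]
  have hfg : (Φ L.VFB (Coloring.universal L)).map f = Coloring.universal K := by
    rw [← nat, hf, hc]
  refine ⟨⟨⟨f.toFun, g.toFun, fun a => ?_, fun a => ?_⟩, f.map_star, f.map_circ⟩⟩
  · exact Coloring.hom_ext
      (f := ⟨fun a => g.toFun (f.toFun a), fun a b => by rw [f.map_star, g.map_star],
        fun a b => by rw [f.map_circ, g.map_circ]⟩)
      (g := ⟨id, fun _ _ => rfl, fun _ _ => rfl⟩) hgf a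
  · exact Coloring.hom_ext
      (f := ⟨fun a => f.toFun (g.toFun a), fun a b => by rw [g.map_star, f.map_star],
        fun a b => by rw [g.map_circ, f.map_circ]⟩)
      (g := ⟨id, fun _ _ => rfl, fun _ _ => rfl⟩) hfg a

/-- The case of two diagrams with the same crossings and natural maps between the colourings that
are inverse to each other. -/
theorem nonempty_iso_of_recoloring {L : SurfaceDiagram} (V : L.Crossing → Prop)
    (n : Equiv.Perm (L.Crossing × Bool))
    (F G : ∀ (X : Type) [VirtualFlatBiquandle X],
      (L.Crossing × Bool → X) → L.Crossing × Bool → X)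
    (hF : ∀ (X : Type) [VirtualFlatBiquandle X] (c : L.Crossing × Bool → X),
      IsColoring L.IsVirtual L.next c → IsColoring V n (F X c) ∧ G X (F X c) = c)
    (hG : ∀ (X : Type) [VirtualFlatBiquandle X] (c : L.Crossing × Bool → X),
      IsColoring V n c → IsColoring L.IsVirtual L.next (G X c) ∧ F X (G X c) = c)
    (nat : ∀ (X Y : Type) [VirtualFlatBiquandle X] [VirtualFlatBiquandle Y]
      (f : VFBHom X Y) (c : L.Crossing × Bool → X),
      F Y (fun p => f.toFun (c p)) = fun p => f.toFun (F X c p)) :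
    Nonempty (VFBIso L.VFB
      (SurfaceDiagram.VFB { L with IsVirtual := V, next := n })) := by
  refine nonempty_iso_of_natural
    (fun X _ c => ⟨F X c.color, c.circleColor, (hF X c.color c.isColoring).1⟩)
    (fun X _ => ⟨fun c c' hc => ?_, fun d => ?_⟩)
    (fun X Y _ _ f c => Coloring.ext (nat X Y f c.color) rfl)
  · refine Coloring.ext ?_ (congrArg (fun d => d.circleColor) hc :)
    rw [← (hF X _ c.isColoring).2, ← (hF X _ c'.isColoring).2]
    exact congrArg (G X) (congrArg (fun d => d.color) hc :)
  · exact ⟨⟨G X d.color, d.circleColor, (hG X d.color d.isColoring).1⟩,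
      Coloring.ext (hG X d.color d.isColoring).2 rfl⟩

/-! ### Flattening crossings that cancel -/

/-- The diagram in which the crossings of `R` have become flat. -/
def flatten (L : SurfaceDiagram) (R : L.Crossing → Prop) : SurfaceDiagram :=
  { L with IsVirtual := fun x => L.IsVirtual x ∧ ¬ R x }

/-- The passes of the crossings in `R` come in pairs of consecutive ones, `p ∈ I` followed by
`L.next p ∉ I`, whose effects on the colour of the strand cancel: they are both virtual or both
flat, from opposite sides, and through the same component of the diagram. -/
structure Cancels (L : SurfaceDiagram) (R : L.Crossing → Prop)
    (I : Set (L.Crossing × Bool)) : Prop where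
  mem : ∀ p ∈ I, R p.1
  next_mem : ∀ p ∈ I, R (L.next p).1
  next_notMem : ∀ p ∈ I, L.next p ∉ I
  prev_mem : ∀ p, R p.1 → p ∉ I → L.next.symm p ∈ I
  virtual_iff : ∀ p ∈ I, L.IsVirtual p.1 ↔ L.IsVirtual (L.next p).1
  side : ∀ p ∈ I, (L.next p).2 = !p.2
  sameCycle : ∀ p ∈ I, L.next.SameCycle (partner p) (partner (L.next p))

section flatten

variable {L : SurfaceDiagram} {R : L.Crossing → Prop} {I : Set (L.Crossing × Bool)}
  {X : Type*} [VirtualFlatBiquandle X]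

theorem pass_flatten_of_mem {p : L.Crossing × Bool} (h : R p.1) (b x : X) :
    pass (fun x => L.IsVirtual x ∧ ¬ R x) p b x = x := pass_of_flat (fun k => k.2 h) b x

theorem pass_flatten_of_notMem {p : L.Crossing × Bool} (h : ¬ R p.1) (b x : X) :
    pass (fun x => L.IsVirtual x ∧ ¬ R x) p b x = pass L.IsVirtual p b x := by
  unfold pass
  by_cases hp : L.IsVirtual p.1
  · rw [if_pos hp, if_pos ⟨hp, h⟩]
  · rw [if_neg hp, if_neg fun k => hp k.1]

theorem Cancels.prev_notMem (h : L.Cancels R I) {p : L.Crossing × Bool}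
    (hp : p ∈ I ∨ ¬ R p.1) : L.next.symm p ∉ I := fun k => by
  rcases hp with hp | hp
  · exact h.next_notMem _ k (by rwa [Equiv.apply_symm_apply])
  · exact hp (by simpa using h.next_mem _ k)

/-- Crossings at which the strands cancel may be made flat. Only the colours of the edges that
leave a pass in `I` change: they become equal to the colours before that pass. -/
theorem Cancels.nonempty_iso_flatten (h : L.Cancels R I) :
    Nonempty (VFBIso L.VFB (L.flatten R).VFB) := by
  classical
  have := L.finite
  refine nonempty_iso_of_recoloring _ L.next
    (fun X _ c p => if p ∈ I then c (L.next.symm p) else c p)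
    (fun X _ w p => if p ∈ I then pass L.IsVirtual p (w (partner p)) (w p) else w p)
    (fun X _ c hc => ⟨fun p => ?_, funext fun p => ?_⟩)
    (fun X _ w hw => ?_) (fun X Y _ _ f c => funext fun p => (apply_ite f.toFun _ _ _).symm)
  · beta_reduce
    by_cases hR : R p.1
    · rw [pass_flatten_of_mem hR]
      by_cases hp : p ∈ I
      · rw [if_pos hp, if_neg (h.prev_notMem (.inl hp))]
      · have hq := h.prev_mem p hR hp
        obtain ⟨q, rfl⟩ := L.next.surjective p
        rw [Equiv.symm_apply_apply] at hq ⊢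
        rw [if_neg hp, if_pos hq, hc.next, hc q]
        exact pass_pass_cancel (h.virtual_iff q hq) (h.side q hq)
          (hc.parallel_of_sameCycle (h.sameCycle q hq)) _
    · rw [pass_flatten_of_notMem hR, if_neg fun k => hR (h.mem p k),
        if_neg fun k => hR (h.mem (partner p) k), if_neg (h.prev_notMem (.inr hR))]
      exact hc p
  · by_cases hp : p ∈ I
    · simp only [if_pos hp]
      have hb : Parallel (if partner p ∈ I then c (L.next.symm (partner p)) else c (partner p))
          (c (partner p)) := by
        split_ifs
        · exact (hc.parallel_prev _).symm
        · exact Parallel.refl _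
      rw [pass_congr p hb]
      exact (hc p).symm
    · simp only [if_neg hp]
  · have hpar : ∀ p, Parallel (if p ∈ I then pass L.IsVirtual p (w (partner p)) (w p)
        else w p) (w p) := fun p => by
      split_ifs
      · exact pass_parallel _ _ _
      · exact Parallel.refl _
    have hprev : ∀ p, R p.1 → w p = w (L.next.symm p) := fun p hp =>
      (hw p).trans (pass_flatten_of_mem hp _ _)
    refine ⟨fun p => ?_, funext fun p => ?_⟩
    · beta_reduce
      rw [pass_congr p (hpar _)]
      by_cases hR : R p.1
      · by_cases hp : p ∈ I
        · simp only [if_pos hp, if_neg (h.prev_notMem (.inl hp)), ← hprev p hR]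
        · have hq := h.prev_mem p hR hp
          obtain ⟨q, rfl⟩ := L.next.surjective p
          have k := hprev _ hR
          rw [Equiv.symm_apply_apply] at hq k ⊢
          rw [if_neg hp, if_pos hq, k]
          exact (pass_pass_cancel (h.virtual_iff q hq) (h.side q hq)
            (hw.parallel_of_sameCycle (h.sameCycle q hq)) _).symm
      · rw [if_neg fun k => hR (h.mem p k), if_neg (h.prev_notMem (.inr hR)),
          ← pass_flatten_of_notMem hR]
        exact hw p
    · by_cases hp : p ∈ I
      · simp only [if_pos hp, if_neg (h.prev_notMem (.inl hp)), ← hprev p (h.mem p hp)]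
      · simp only [if_neg hp]

end flatten

/-! ### Removing flat crossings -/

section removal

variable {L K : SurfaceDiagram} {R : L.Crossing → Prop}

/-- The strand that leaves the pass `p` only meets crossings of `R` until it leaves the pass
`r`. -/
inductive Trails (L : SurfaceDiagram) (R : L.Crossing → Prop) (p : L.Crossing × Bool) :
    L.Crossing × Bool → Prop where
  | refl : Trails L R p p
  | step : ∀ r, Trails L R p r → R (L.next r).1 → Trails L R p (L.next r)

theorem Trails.sameCycle {p r : L.Crossing × Bool} (h : L.Trails R p r) :
    L.next.SameCycle p r := by
  induction h with
  | refl => exact Equiv.Perm.SameCycle.refl _ _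
  | step r _ _ ih => exact Equiv.Perm.sameCycle_apply_right.2 ih

theorem trails_pow (p : L.Crossing × Bool) (k : ℕ) (h : ∀ j < k, R ((L.next ^ (j + 1)) p).1) :
    L.Trails R p ((L.next ^ k) p) := by
  induction k with
  | zero => exact .refl
  | succ k ih =>
    have hk := h k k.lt_succ_self
    rw [pow_succ', Equiv.Perm.mul_apply] at hk ⊢
    exact .step _ (ih fun j hj => h j (hj.trans k.lt_succ_self)) hk

/-- The pass outside `R` that a strand has gone through last is unique. -/
theorem Trails.unique {p q r : L.Crossing × Bool} (hp : ¬ R p.1) (hq : ¬ R q.1)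
    (h : L.Trails R p r) (k : L.Trails R q r) : p = q := by
  induction h with
  | refl =>
    cases k with
    | refl => rfl
    | step r _ hr => exact (hp hr).elim
  | step r _ hr ih =>
    generalize hs : L.next r = s at k hr
    cases k with
    | refl => exact (hq hr).elim
    | step r' k' _ => exact ih (L.next.injective hs ▸ k')

/-- A strand either has gone through a pass outside `R` or lies on a component with all its
crossings in `R`. -/
theorem exists_trails (r : L.Crossing × Bool) (h : ∃ p, L.next.SameCycle p r ∧ ¬ R p.1) :
    ∃ p, ¬ R p.1 ∧ L.Trails R p r := by
  have := L.finite
  obtain ⟨p, hpr, hp⟩ := h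
  obtain ⟨n, rfl⟩ := hpr.exists_nat_pow_eq
  clear hpr
  induction n with
  | zero => exact ⟨p, hp, .refl⟩
  | succ n ih =>
    obtain ⟨q, hq, hqn⟩ := ih
    rw [pow_succ', Equiv.Perm.mul_apply]
    by_cases hR : R (L.next ((L.next ^ n) p)).1
    · exact ⟨q, hq, .step _ hqn hR⟩
    · exact ⟨_, hR, .refl⟩

theorem Trails.color_eq {X : Type*} [VirtualFlatBiquandle X] (hflat : ∀ x, R x → ¬ L.IsVirtual x)
    (c : L.Coloring X) {p r : L.Crossing × Bool} (h : L.Trails R p r) :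
    c.color r = c.color p := by
  induction h with
  | refl => rfl
  | step r _ hr ih => rw [c.isColoring.next, pass_of_flat (hflat _ hr), ih]

/-- Along a component with all its crossings in `R`, all flat, the colour does not change. -/
theorem Coloring.color_eq_of_sameCycle {X : Type*} [VirtualFlatBiquandle X]
    (hflat : ∀ x, R x → ¬ L.IsVirtual x) (c : L.Coloring X) {p r : L.Crossing × Bool}
    (h : L.next.SameCycle p r) (hR : ∀ q, L.next.SameCycle p q → R q.1) :
    c.color r = c.color p := by
  have := L.finite
  obtain ⟨n, rfl⟩ := h.exists_nat_pow_eq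
  exact (trails_pow p n fun j _ => hR _ (Equiv.Perm.sameCycle_pow_right.2
    (Equiv.Perm.SameCycle.refl _ _))).color_eq hflat c

/-- Removing flat crossings does not change the fundamental virtual flat biquandle. -/
theorem IsResultOfRemoving.nonempty_iso_of_flat (h : K.IsResultOfRemoving L R)
    (hflat : ∀ x, R x → ¬ L.IsVirtual x) : Nonempty (VFBIso L.VFB K.VFB) := by
  classical
  have := L.finite
  obtain ⟨e, hv, hn, hc⟩ := h
  let Full := {c : Quotient (Equiv.Perm.SameCycle.setoid L.next) //
    ∀ p, Quotient.mk _ p = c → R p.1}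
  have t : Fin K.circles ≃ Fin L.circles ⊕ Full :=
    (finCongr hc).trans (finSumFinEquiv.symm.trans
      ((Equiv.refl _).sumCongr (Finite.equivFin Full).symm))
  let ε : K.Crossing × Bool → L.Crossing × Bool := fun q => (↑(e q.1), q.2)
  have hε : ∀ q, ¬ R (ε q).1 := fun q => (e q.1).2
  have ε_inj : ∀ q q', ε q = ε q' → q = q' := fun q q' hq =>
    Prod.ext (e.injective (Subtype.ext (congrArg (fun p => p.1) hq :)))
      (congrArg (fun p => p.2) hq :)
  have ε_surj : ∀ p, ¬ R p.1 → ∃ q, ε q = p := fun p hp =>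
    ⟨(e.symm ⟨p.1, hp⟩, p.2), by simp [ε]⟩
  -- The edge of `K` that arrives at `q` is the trail of its first pass.
  have hprev : ∀ q, L.Trails R (ε (K.next.symm q)) (L.next.symm (ε q)) := fun q => by
    obtain ⟨k, hk, hR⟩ := hn (K.next.symm q).1 (K.next.symm q).2
    have hk' : (L.next ^ (k + 1)) (ε (K.next.symm q)) = ε q := by
      rw [show ε (K.next.symm q) = (↑(e (K.next.symm q).1), (K.next.symm q).2) from rfl, hk]
      simp [ε]
    rw [← hk', pow_succ', Equiv.Perm.mul_apply, Equiv.symm_apply_apply]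
    exact trails_pow _ k hR
  have hpass : ∀ {X : Type} [VirtualFlatBiquandle X] (q : K.Crossing × Bool) (b x : X),
      pass L.IsVirtual (ε q) b x = pass K.IsVirtual q b x := fun q b x => by
    unfold pass
    exact if_congr (hv q.1).symm rfl rfl
  let Φ : ∀ (X : Type) [VirtualFlatBiquandle X], L.Coloring X → K.Coloring X := fun X _ c =>
    { color := fun q => c.color (ε q)
      circleColor := fun i => Sum.elim c.circleColor (fun m : Full => c.color m.1.out) (t i)
      isColoring := fun q => by
        beta_reduce
        rw [c.isColoring, hpass, (hprev q).color_eq hflat c]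
        rfl }
  refine nonempty_iso_of_natural Φ (fun X _ => ⟨fun c c' hcc => ?_, fun d => ?_⟩)
    fun X Y _ _ f c => Coloring.ext rfl (funext fun i => ?_)
  · have hcol : ∀ q, c.color (ε q) = c'.color (ε q) :=
      congrFun (congrArg Coloring.color hcc)
    have hcirc : ∀ i, Sum.elim c.circleColor (fun m : Full => c.color m.1.out) i =
        Sum.elim c'.circleColor (fun m : Full => c'.color m.1.out) i := fun i => by
      have := congrFun (congrArg Coloring.circleColor hcc) (t.symm i)
      simpa only [Φ, Equiv.apply_symm_apply] using this
    refine Coloring.ext (funext fun r => ?_) (funext fun i => hcirc (.inl i))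
    by_cases hr : ∃ p, L.next.SameCycle p r ∧ ¬ R p.1
    · obtain ⟨p, hp, hpr⟩ := exists_trails r hr
      obtain ⟨q, rfl⟩ := ε_surj p hp
      rw [hpr.color_eq hflat, hpr.color_eq hflat, hcol]
    · push Not at hr
      have hm : ∀ p, (Quotient.mk (Equiv.Perm.SameCycle.setoid L.next) p) =
          Quotient.mk _ r → R p.1 := fun p hp => hr p (Quotient.exact hp)
      have hout : L.next.SameCycle r
          (Quotient.out (Quotient.mk (Equiv.Perm.SameCycle.setoid L.next) r)) :=
        (Quotient.mk_out (s := Equiv.Perm.SameCycle.setoid L.next) r).symm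
      have hall : ∀ q, L.next.SameCycle r q → R q.1 := fun q hq => hr q hq.symm
      rw [← c.color_eq_of_sameCycle hflat hout hall, ← c'.color_eq_of_sameCycle hflat hout hall]
      exact hcirc (.inr ⟨_, hm⟩)
  · -- An edge of `L` gets the colour of the edge of `K` or the component of `K` that contains it.
    have hfull : ∀ r, (¬ ∃ q, L.Trails R (ε q) r) →
        ∀ p, Quotient.mk (Equiv.Perm.SameCycle.setoid L.next) p = Quotient.mk _ r → R p.1 := by
      intro r hr p hp
      by_contra hRp
      obtain ⟨p', hp', hpr⟩ := exists_trails r ⟨p, Quotient.exact hp, hRp⟩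
      obtain ⟨q, rfl⟩ := ε_surj p' hp'
      exact hr ⟨q, hpr⟩
    let w : L.Crossing × Bool → X := fun r =>
      if hr : ∃ q, L.Trails R (ε q) r then d.color hr.choose
      else d.circleColor (t.symm (.inr ⟨Quotient.mk _ r, hfull r hr⟩))
    have hw : ∀ q r, L.Trails R (ε q) r → w r = d.color q := fun q r hq => by
      have hr : ∃ q, L.Trails R (ε q) r := ⟨q, hq⟩
      rw [show w r = d.color hr.choose from dif_pos hr]
      exact congrArg d.color (ε_inj _ _ (hr.choose_spec.unique (hε _) (hε _) hq))
    have hw' : ∀ (r : L.Crossing × Bool) (m : Full), Quotient.mk _ r = m.1 →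
        w r = d.circleColor (t.symm (.inr m)) := by
      rintro r ⟨m, hm⟩ rfl
      have hr : ¬ ∃ q, L.Trails R (ε q) r := fun ⟨q, hq⟩ =>
        hε q (hm _ (Quotient.sound hq.sameCycle))
      exact dif_neg hr
    refine ⟨⟨w, fun i => d.circleColor (t.symm (.inl i)), fun r => ?_⟩,
      Coloring.ext (funext fun q => hw q _ .refl) (funext fun i => ?_)⟩
    · by_cases hR : R r.1
      · rw [pass_of_flat (hflat _ hR)]
        by_cases hr : ∃ q, L.Trails R (ε q) (L.next.symm r)
        · obtain ⟨q, hq⟩ := hr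
          have hq' := Trails.step _ hq (by rwa [Equiv.apply_symm_apply])
          rw [Equiv.apply_symm_apply] at hq'
          rw [hw q _ hq, hw q _ hq']
        · have hm : Quotient.mk (Equiv.Perm.SameCycle.setoid L.next) r =
              Quotient.mk _ (L.next.symm r) := by
            refine Quotient.sound ?_
            change L.next.SameCycle r (L.next.symm r)
            exact ⟨-1, by simp⟩
          rw [hw' _ ⟨_, hfull _ hr⟩ rfl, hw' r ⟨_, hfull _ hr⟩ hm]
      · obtain ⟨q, rfl⟩ := ε_surj r hR
        have hq : partner (ε q) = ε (partner q) := rfl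
        rw [hw q _ .refl, hq, hw (partner q) _ .refl, hw _ _ (hprev q), hpass]
        exact d.isColoring q
    · change Sum.elim (fun i => d.circleColor (t.symm (.inl i)))
        (fun m : Full => w m.1.out) (t i) = d.circleColor i
      rcases ht : t i with j | m
      · rw [Sum.elim_inl, ← ht, Equiv.symm_apply_apply]
      · rw [Sum.elim_inr, hw' _ m (Quotient.out_eq _), ← ht, Equiv.symm_apply_apply]
  · change Sum.elim (fun i => f.toFun (c.circleColor i)) (fun m : Full => f.toFun
      (c.color m.1.out)) (t i) = f.toFun (Sum.elim c.circleColor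
        (fun m : Full => c.color m.1.out) (t i))
    rcases t i with j | m <;> rfl

/-- Removing crossings at which the strands cancel does not change the fundamental virtual flat
biquandle: they may be made flat first. -/
theorem IsResultOfRemoving.nonempty_iso_of_cancels {I : Set (L.Crossing × Bool)}
    (h : K.IsResultOfRemoving L R) (hI : L.Cancels R I) : Nonempty (VFBIso L.VFB K.VFB) := by
  obtain ⟨f⟩ := hI.nonempty_iso_flatten
  have h' : K.IsResultOfRemoving (L.flatten R) R := by
    obtain ⟨e, hv, hn, hc⟩ := h
    exact ⟨e, fun x => (hv x).trans ⟨fun k => ⟨k, (e x).2⟩, fun k => k.1⟩, hn, hc⟩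
  obtain ⟨g⟩ := h'.nonempty_iso_of_flat fun x hx k => k.2 hx
  exact ⟨f.trans g⟩

end removal

/-! ### Interchanging consecutive passes -/

section interchange

open Classical in
/-- When the consecutive passes `p` and `q = n p` are interchanged, the edge between them, which
then leaves `q`, gets the colour that is left if the strand goes through `q` first. -/
noncomputable def interchange {C X : Type*} [VirtualFlatBiquandle X] (V : C → Prop)
    (n : Equiv.Perm (C × Bool)) (p q : C × Bool) (c : C × Bool → X) (u : C × Bool) : X :=
  if u = q then pass V q (c (partner q)) (c (n.symm p)) else c (Equiv.swap p q u)

open Classical in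
theorem IsColoring.interchange {C X : Type*} [VirtualFlatBiquandle X] [Finite C] {V : C → Prop}
    {n m : Equiv.Perm (C × Bool)} {p q : C × Bool} (hpq : p ≠ q) (hn : n p = q)
    (hm : ∀ u, m (Equiv.swap p q u) = Equiv.swap p q (n u)) {c : C × Bool → X}
    (h : IsColoring V n c) :
    IsColoring V m (interchange V n p q c) ∧
      SurfaceDiagram.interchange V m q p (SurfaceDiagram.interchange V n p q c) = c := by
  have hm' : ∀ u, m.symm (Equiv.swap p q u) = Equiv.swap p q (n.symm u) := fun u => by
    rw [Equiv.symm_apply_eq, hm, Equiv.apply_symm_apply]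
  have hnq : n.symm q = p := by rw [← hn, Equiv.symm_apply_apply]
  have hmp : m.symm p = q := by
    have := hm' q
    rwa [Equiv.swap_apply_right, hnq, Equiv.swap_apply_left] at this
  have hmq : m.symm q = Equiv.swap p q (n.symm p) := by
    have := hm' p
    rwa [Equiv.swap_apply_left] at this
  have hnp : n.symm p ≠ p := fun k => hpq (((Equiv.symm_apply_eq n).1 k).trans hn)
  have hcyc : n.SameCycle p q := hn ▸ Equiv.Perm.sameCycle_apply_right.2 (.refl _ _)
  have hne : ∀ u, u ≠ q → n.symm u ≠ p := fun u hu hp => hu (by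
    rw [← hn, ← hp, Equiv.apply_symm_apply])
  -- The colours are those of `c` up to the interchange, except on the edge from `p` to `q`.
  have hval : ∀ u, u ≠ p → SurfaceDiagram.interchange V n p q c (Equiv.swap p q u) = c u := by
    intro u hu
    rw [SurfaceDiagram.interchange, if_neg, Equiv.swap_apply_self]
    intro k
    exact hu ((Equiv.swap p q).injective (k.trans (Equiv.swap_apply_left p q).symm))
  have hvalq : SurfaceDiagram.interchange V n p q c q =
      pass V q (c (partner q)) (c (n.symm p)) := if_pos rfl
  have hvalp : SurfaceDiagram.interchange V n p q c p = c q := by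
    have := hval q hpq.symm
    rwa [Equiv.swap_apply_right] at this
  have hpar : ∀ u, Parallel (SurfaceDiagram.interchange V n p q c u) (c u) := by
    intro u
    by_cases hu : u = q
    · rw [hu, hvalq]
      refine (pass_parallel _ _ _).trans ((h.parallel_prev p).symm.trans ?_)
      exact h.parallel_of_sameCycle hcyc
    · rw [SurfaceDiagram.interchange, if_neg hu]
      by_cases hup : u = p
      · rw [hup, Equiv.swap_apply_left]
        exact h.parallel_of_sameCycle hcyc.symm
      · rw [Equiv.swap_apply_of_ne_of_ne hup hu]
        exact Parallel.refl _
  constructor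
  · intro u
    rw [pass_congr u (hpar _)]
    by_cases hu : u = q
    · subst hu
      rw [hvalq, hmq, hval _ hnp]
    · by_cases hup : u = p
      · -- Both orders of the two passes have the same effect on the strand.
        rw [hup, hmp, hvalp, hvalq, pass_comm, ← h p]
        have := h q
        rwa [hnq] at this
      · have hs : Equiv.swap p q u = u := Equiv.swap_apply_of_ne_of_ne hup hu
        have hmu := hm' u
        rw [hs] at hmu
        have hu' := hval u hup
        rw [hs] at hu'
        rw [hmu, hval _ (hne u hu), hu']
        exact h u
  · funext u
    by_cases hu : u = p
    · rw [hu, SurfaceDiagram.interchange, if_pos rfl, hmq,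
        hval _ hnp,
        pass_congr p (hpar _)]
      exact (h p).symm
    · rw [SurfaceDiagram.interchange, if_neg hu, Equiv.swap_comm, hval u hu]

open Classical in
/-- The interchange of two consecutive passes does not change the fundamental virtual flat
biquandle, since the operators by which they act commute. -/
theorem nonempty_iso_interchange (L : SurfaceDiagram) (p : L.Crossing × Bool)
    (m : Equiv.Perm (L.Crossing × Bool))
    (hm : ∀ u, m (Equiv.swap p (L.next p) u) = Equiv.swap p (L.next p) (L.next u)) :
    Nonempty (VFBIso L.VFB (SurfaceDiagram.VFB { L with next := m })) := by
  have := L.finite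
  by_cases hp : p = L.next p
  · rw [← hp] at hm
    obtain rfl : m = L.next := Equiv.ext fun u => by simpa using hm u
    exact ⟨⟨Equiv.refl _, fun _ _ => rfl, fun _ _ => rfl⟩⟩
  · have hmq : m (L.next p) = p := by
      have := hm p
      rwa [Equiv.swap_apply_left, Equiv.swap_apply_right] at this
    have hm' : ∀ u, L.next (Equiv.swap (L.next p) p u) = Equiv.swap (L.next p) p (m u) := by
      intro u
      have := hm (Equiv.swap p (L.next p) u)
      rw [Equiv.swap_apply_self] at this
      rw [this, Equiv.swap_comm, Equiv.swap_apply_self]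
    refine nonempty_iso_of_recoloring L.IsVirtual m
      (fun X _ => interchange L.IsVirtual L.next p (L.next p))
      (fun X _ => interchange L.IsVirtual m (L.next p) p)
      (fun X _ c hc => hc.interchange hp rfl hm)
      (fun X _ c hc => hc.interchange (Ne.symm hp) hmq hm')
      fun X Y _ _ f c => funext fun u => ?_
    unfold interchange
    rw [apply_ite f.toFun, map_pass]

end interchange

/-! ### The Reidemeister moves -/

section moves

variable {L K : SurfaceDiagram}

/-- The edge of a dart `d` joins the pass of `d` with the partner of the pass of `L.face d`.
The darts `d` and `L.face d` are ends of the same kind, both outgoing or both incoming, exactly if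
the pass of `L.face d` comes from the left. -/
theorem edge_of_face_eq {d d' : L.Dart} (h : L.face d = d') :
    ((L.edgeOf d = d.1 ∧ L.next d.1 = partner d'.1) ∨
      (L.edgeOf d = partner d'.1 ∧ L.next (partner d'.1) = d.1)) ∧
    d'.2 = (d'.1.2 == d.2) := by
  subst h
  obtain ⟨p, t⟩ := d
  cases t
  · obtain ⟨⟨y, b⟩, rfl⟩ : ∃ q, L.next q = p := L.next.surjective p
    change ((L.next.symm _ = _ ∧ _) ∨ (L.next.symm _ = partner (L.clockwise
      (L.next.symm _, true)).1 ∧ L.next (partner (L.clockwise (L.next.symm _, true)).1) = _)) ∧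
      (L.clockwise (L.next.symm _, true)).2 = ((L.clockwise (L.next.symm _, true)).1.2 == false)
    rw [Equiv.symm_apply_apply]
    cases b
    · exact ⟨.inr ⟨rfl, rfl⟩, rfl⟩
    · exact ⟨.inr ⟨rfl, rfl⟩, rfl⟩
  · obtain ⟨⟨y, b⟩, hq⟩ : ∃ q, L.next p = q := ⟨_, rfl⟩
    change ((p = p ∧ L.next p = partner (L.clockwise (L.next p, false)).1) ∨ _) ∧
      (L.clockwise (L.next p, false)).2 = ((L.clockwise (L.next p, false)).1.2 == true)
    rw [hq]
    cases b
    · exact ⟨.inl ⟨rfl, rfl⟩, rfl⟩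
    · exact ⟨.inl ⟨rfl, rfl⟩, rfl⟩

theorem partner_partner {C : Type*} (p : C × Bool) : partner (partner p) = p := by
  simp [partner]

theorem eq_or_eq_partner {C : Type*} {p q : C × Bool} (h : p.1 = q.1) :
    p = q ∨ p = partner q := by
  obtain ⟨x, s⟩ := p
  obtain ⟨y, t⟩ := q
  obtain rfl : x = y := h
  cases s <;> cases t <;> simp [partner]

theorem partner_ne {C : Type*} (p : C × Bool) : partner p ≠ p := fun h => by
  have := congrArg Prod.snd h
  simp [partner] at this

/-- The two passes of the crossing of a monogon follow each other, from opposite sides. -/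
theorem cancels_of_next_eq_partner {p : L.Crossing × Bool} (h : L.next p = partner p) :
    L.Cancels (fun x => x = p.1) {p} where
  mem := by rintro _ rfl; rfl
  next_mem := by rintro _ rfl; rw [h]; rfl
  next_notMem := by
    rintro _ rfl
    rw [h]
    exact partner_ne _
  prev_mem := by
    intro q hq hqp
    rcases eq_or_eq_partner hq with rfl | rfl
    · exact (hqp rfl).elim
    · exact (Equiv.symm_apply_eq _).2 h.symm
  virtual_iff := by rintro _ rfl; rw [h]; rfl
  side := by rintro _ rfl; rw [h]; rfl
  sameCycle := by
    rintro _ rfl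
    rw [h, partner_partner, ← h]
    exact Equiv.Perm.sameCycle_apply_left.2 (.refl _ _)

/-- Two edges `p → L.next p` and `p' → L.next p'` between the same two crossings. The strand of
each edge meets the other one at both of its ends. -/
theorem cancels_of_two_edges {p p' : L.Crossing × Bool} (hne : (L.next p).1 ≠ p.1)
    (hs : (L.next p).2 = !p.2) (hv : L.IsVirtual p.1 ↔ L.IsVirtual (L.next p).1)
    (h : (p' = partner p ∧ L.next p' = partner (L.next p)) ∨
      (p' = partner (L.next p) ∧ L.next p' = partner p)) :
    L.Cancels (fun x => x = p.1 ∨ x = (L.next p).1) {p, p'} := by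
  obtain ⟨q, hq⟩ : ∃ q, L.next p = q := ⟨_, rfl⟩
  obtain ⟨q', hq'⟩ : ∃ q', L.next p' = q' := ⟨_, rfl⟩
  rw [hq] at hne hs hv h ⊢
  rw [hq'] at h
  have hedge : L.next.SameCycle (partner p) (partner q) := by
    rcases h with ⟨rfl, rfl⟩ | ⟨rfl, rfl⟩
    · exact hq' ▸ Equiv.Perm.sameCycle_apply_right.2 (.refl _ _)
    · exact hq' ▸ Equiv.Perm.sameCycle_apply_left.2 (.refl _ _)
  have hedge' : L.next.SameCycle (partner p') (partner q') := by
    have hpq : L.next.SameCycle p q := hq ▸ Equiv.Perm.sameCycle_apply_right.2 (.refl _ _)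
    rcases h with ⟨rfl, rfl⟩ | ⟨rfl, rfl⟩ <;> rw [partner_partner, partner_partner]
    · exact hpq
    · exact hpq.symm
  have hp : L.next.symm q = p := (Equiv.symm_apply_eq _).2 hq.symm
  have hp' : L.next.symm q' = p' := (Equiv.symm_apply_eq _).2 hq'.symm
  have hpp : partner p ≠ p := partner_ne p
  have hqq : partner q ≠ q := partner_ne q
  have hpq₀ : q ≠ p := fun k => hne (congrArg Prod.fst k)
  have hpq₁ : partner q ≠ p := fun k => hne (congrArg (fun z => z.1) k :)
  have hpq₂ : q ≠ partner p := fun k => hne (congrArg (fun z => z.1) k :)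
  have hpq₃ : partner q ≠ partner p := fun k => hne (congrArg (fun z => z.1) k :)
  constructor
  · rintro _ (rfl | rfl)
    · exact .inl rfl
    · rcases h with ⟨rfl, -⟩ | ⟨rfl, -⟩
      · exact .inl rfl
      · exact .inr rfl
  · rintro _ (rfl | rfl)
    · exact .inr (by rw [hq])
    · rw [hq']
      rcases h with ⟨-, rfl⟩ | ⟨-, rfl⟩
      · exact .inr rfl
      · exact .inl rfl
  · rintro _ (rfl | rfl)
    · rw [hq]
      rcases h with ⟨rfl, -⟩ | ⟨rfl, -⟩
      · exact not_or.2 ⟨hpq₀, hpq₂⟩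
      · exact not_or.2 ⟨hpq₀, hqq.symm⟩
    · rw [hq']
      rcases h with ⟨rfl, rfl⟩ | ⟨rfl, rfl⟩
      · exact not_or.2 ⟨hpq₁, hpq₃⟩
      · exact not_or.2 ⟨hpp, hpq₃.symm⟩
  · intro r hr hrI
    have hrI' : r ≠ p ∧ r ≠ p' := not_or.1 hrI
    have : r = q ∨ r = q' := by
      rcases hr with hr | hr <;> rcases eq_or_eq_partner hr with rfl | rfl <;>
        rcases h with ⟨rfl, rfl⟩ | ⟨rfl, rfl⟩ <;> simp_all
    rcases this with rfl | rfl
    · exact .inl hp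
    · exact .inr hp'
  · rintro _ (rfl | rfl)
    · rwa [hq]
    · rw [hq']
      rcases h with ⟨rfl, rfl⟩ | ⟨rfl, rfl⟩
      · exact hv
      · exact hv.symm
  · rintro _ (rfl | rfl)
    · rwa [hq]
    · rw [hq']
      rcases h with ⟨rfl, rfl⟩ | ⟨rfl, rfl⟩ <;> simp [partner, hs]
  · rintro _ (rfl | rfl)
    · rwa [hq]
    · rwa [hq']

theorem MoveOne.nonempty_iso (h : MoveOne L K) : Nonempty (VFBIso L.VFB K.VFB) := by
  obtain ⟨d, hd, hK⟩ := h
  rcases (edge_of_face_eq hd).1 with ⟨-, h⟩ | ⟨-, h⟩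
  · exact hK.nonempty_iso_of_cancels (cancels_of_next_eq_partner h)
  · exact hK.nonempty_iso_of_cancels
      (cancels_of_next_eq_partner (p := partner d.1) (by rw [h, partner_partner]))

theorem MoveTwo.nonempty_iso (h : MoveTwo L K) : Nonempty (VFBIso L.VFB K.VFB) := by
  obtain ⟨d, hd, hne, hv, hK⟩ := h
  obtain ⟨d', hd'⟩ : ∃ d', L.face d = d' := ⟨_, rfl⟩
  rw [hd'] at hd hne hv hK
  obtain ⟨h₁, ht₁⟩ := edge_of_face_eq hd'
  obtain ⟨h₂, ht₂⟩ := edge_of_face_eq hd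
  -- Each edge of a bigon arrives from the side opposite to the one from which it has left.
  have hs : d'.1.2 = d.1.2 := by
    revert ht₁ ht₂
    generalize d.2 = a
    generalize d'.2 = b
    generalize d.1.2 = s
    generalize d'.1.2 = t
    revert a b s t
    decide
  obtain ⟨p', hp'⟩ : ∃ p', (p' = partner d.1 ∧ L.next p' = d'.1) ∨
      (p' = d'.1 ∧ L.next p' = partner d.1) := by
    rcases h₂ with ⟨-, h₂⟩ | ⟨-, h₂⟩
    · exact ⟨_, .inr ⟨rfl, h₂⟩⟩
    · exact ⟨_, .inl ⟨rfl, h₂⟩⟩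
  rcases h₁ with ⟨-, h₁⟩ | ⟨-, h₁⟩
  · have hc := cancels_of_two_edges (L := L) (p := d.1) (p' := p')
      (by rw [h₁]; exact hne.symm) (by rw [h₁]; simp [partner, hs]) (by rwa [h₁])
      (by rwa [h₁, partner_partner])
    rw [h₁] at hc
    exact hK.nonempty_iso_of_cancels hc
  · have hc := cancels_of_two_edges (L := L) (p := partner d'.1) (p' := p')
      (by rw [h₁]; exact hne) (by rw [h₁]; simp [partner, hs]) (by rw [h₁]; exact hv.symm)
      (by rw [h₁, partner_partner]; exact hp'.symm)
    rw [h₁] at hc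
    have hR : (fun x => x = L.crossingOf d ∨ x = L.crossingOf d') =
        fun x => x = (partner d'.1).1 ∨ x = d.1.1 := funext fun x => propext or_comm
    rw [hR] at hK
    exact hK.nonempty_iso_of_cancels hc

/-- A renaming of the crossings, as the removal of no crossing. -/
theorem isResultOfRemoving_of_equiv (e : L.Crossing ≃ K.Crossing)
    (hv : ∀ x, L.IsVirtual x ↔ K.IsVirtual (e x))
    (hn : ∀ p, K.next (Prod.map e id p) = Prod.map e id (L.next p))
    (hc : K.circles = L.circles) : K.IsResultOfRemoving L (fun _ => False) := by
  refine ⟨e.symm.trans (Equiv.subtypeUnivEquiv fun _ => not_false).symm, fun x => ?_,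
    fun x s => ⟨0, ?_, by simp⟩, ?_⟩
  · rw [hv]
    simp
  · have h := hn (e.symm x, s)
    simp only [Prod.map, Equiv.apply_symm_apply, id] at h
    rw [h]
    simp
  · have : IsEmpty {c : Quotient (Equiv.Perm.SameCycle.setoid L.next) //
        ∀ p, Quotient.mk _ p = c → False} :=
      ⟨fun c => c.2 _ (Quotient.out_eq c.1)⟩
    rw [hc, Nat.card_of_isEmpty, add_zero]

/-- Consecutive edges of a triangle have no pass in common, so their interchanges do not
interfere. -/
theorem swapEnds_triangle {d₁ d₂ d₃ : L.Dart} (h₁₂ : L.face d₁ = d₂) (h₂₃ : L.face d₂ = d₃)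
    (hne₁₂ : L.crossingOf d₁ ≠ L.crossingOf d₂) (hne₂₃ : L.crossingOf d₂ ≠ L.crossingOf d₃)
    (hne₃₁ : L.crossingOf d₃ ≠ L.crossingOf d₁) :
    (L.swapEnds d₂ (L.edgeOf d₁) = L.edgeOf d₁ ∧
      L.swapEnds d₂ (L.next (L.edgeOf d₁)) = L.next (L.edgeOf d₁)) ∧
    (L.swapEnds d₁ (L.edgeOf d₂) = L.edgeOf d₂ ∧
      L.swapEnds d₁ (L.next (L.edgeOf d₂)) = L.next (L.edgeOf d₂)) := by
  classical
  have n₁ : d₁.1 ≠ d₂.1 := fun k => hne₁₂ (congrArg (fun z => z.1) k :)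
  have n₂ : partner d₂.1 ≠ partner d₃.1 := fun k => hne₂₃ (congrArg (fun z => z.1) k :)
  have n₃ : d₁.1 ≠ partner d₃.1 := fun k => hne₃₁ (congrArg (fun z => z.1) k.symm :)
  have n₄ : partner d₂.1 ≠ d₂.1 := partner_ne _
  unfold swapEnds
  rcases (edge_of_face_eq h₁₂).1 with ⟨e₁, f₁⟩ | ⟨e₁, f₁⟩ <;>
    rcases (edge_of_face_eq h₂₃).1 with ⟨e₂, f₂⟩ | ⟨e₂, f₂⟩ <;>
    rw [e₁, e₂, f₁, f₂] <;>
    refine ⟨⟨?_, ?_⟩, ?_, ?_⟩ <;> apply Equiv.swap_apply_of_ne_of_ne <;>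
    first | assumption | (apply Ne.symm; assumption)

/-- The triangle move is an interchange of consecutive passes on each of the three strands. -/
theorem MoveThree.nonempty_iso (h : MoveThree L K) : Nonempty (VFBIso L.VFB K.VFB) := by
  classical
  obtain ⟨d₁, d₂, d₃, h₁₂, h₂₃, h₃₁, hne₁₂, hne₂₃, hne₃₁, -, e, hv, hn, hc⟩ := h
  obtain ⟨⟨a₁, a₂⟩, -⟩ := swapEnds_triangle h₁₂ h₂₃ hne₁₂ hne₂₃ hne₃₁
  obtain ⟨⟨b₁, b₂⟩, -⟩ := swapEnds_triangle h₂₃ h₃₁ hne₂₃ hne₃₁ hne₁₂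
  obtain ⟨-, c₁, c₂⟩ := swapEnds_triangle h₃₁ h₁₂ hne₃₁ hne₁₂ hne₂₃
  have hs : ∀ d u, L.swapEnds d (L.swapEnds d u) = u := fun d u => Equiv.swap_apply_self _ _ u
  let m₃ := L.swapEnds d₃ * L.next * L.swapEnds d₃
  let m₂ := L.swapEnds d₂ * m₃ * L.swapEnds d₂
  let m₁ := L.swapEnds d₁ * m₂ * L.swapEnds d₁
  have k₂ : m₃ (L.edgeOf d₂) = L.next (L.edgeOf d₂) := by
    simp only [m₃, Equiv.Perm.mul_apply, b₁, b₂]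
  have k₁ : m₂ (L.edgeOf d₁) = L.next (L.edgeOf d₁) := by
    simp only [m₂, m₃, Equiv.Perm.mul_apply, a₁, a₂, c₁, c₂]
  obtain ⟨f₃⟩ := nonempty_iso_interchange L (L.edgeOf d₃) m₃ fun u =>
    congrArg (fun v => L.swapEnds d₃ (L.next v)) (hs d₃ u)
  obtain ⟨f₂⟩ := nonempty_iso_interchange { L with next := m₃ } (L.edgeOf d₂) m₂ fun u => by
    change m₂ (Equiv.swap _ (m₃ (L.edgeOf d₂)) u) = Equiv.swap _ (m₃ (L.edgeOf d₂)) (m₃ u)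
    rw [k₂]
    exact congrArg (fun v => L.swapEnds d₂ (m₃ v)) (hs d₂ u)
  obtain ⟨f₁⟩ := nonempty_iso_interchange { L with next := m₂ } (L.edgeOf d₁) m₁ fun u => by
    change m₁ (Equiv.swap _ (m₂ (L.edgeOf d₁)) u) = Equiv.swap _ (m₂ (L.edgeOf d₁)) (m₂ u)
    rw [k₁]
    exact congrArg (fun v => L.swapEnds d₁ (m₂ v)) (hs d₁ u)
  have hK : K.IsResultOfRemoving { L with next := m₁ } (fun _ => False) := by
    refine isResultOfRemoving_of_equiv (L := { L with next := m₁ }) e hv (fun p => ?_) hc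
    have h := hn (L.swapEnds d₃ (L.swapEnds d₂ (L.swapEnds d₁ p)))
    simp only [Equiv.Perm.mul_apply, hs] at h
    exact h
  obtain ⟨g⟩ := hK.nonempty_iso_of_flat fun _ hx => hx.elim
  exact ⟨((f₃.trans f₂).trans f₁).trans g⟩

theorem FlatReidemeister.nonempty_iso (h : FlatReidemeister L K) :
    Nonempty (VFBIso L.VFB K.VFB) := by
  have hsymm : Nonempty (VFBIso K.VFB L.VFB) → Nonempty (VFBIso L.VFB K.VFB) :=
    fun ⟨f⟩ => ⟨f.symm⟩
  rcases h with h | h | h | h | h | h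
  · exact h.nonempty_iso
  · exact hsymm h.nonempty_iso
  · exact h.nonempty_iso
  · exact hsymm h.nonempty_iso
  · exact h.nonempty_iso
  · exact hsymm h.nonempty_iso

end moves

end SurfaceDiagram

theorem theorem4p3 :
    (∀ (X : Type*) [VirtualFlatBiquandle X],
      IsFlatBiquandle (VirtualFlatBiquandle.star : X → X → X) VirtualFlatBiquandle.circ) ∧
    (∀ L L' : FlatVirtualLinkDiagram,
      L.toSurfaceDiagram.FlatReidemeister L'.toSurfaceDiagram →
      Nonempty (VFBIso L.toSurfaceDiagram.VFB L'.toSurfaceDiagram.VFB)) := by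
  exact ⟨fun _ _ => VirtualFlatBiquandle.isFlatBiquandle, fun _ _ h => h.nonempty_iso⟩
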